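/- Let $L$ be a locally compact group with neutral element $e$, and let $\mathcal P(L)$ be the set of continuous functions $\varphi:L\to\mathbb C$ such that $(u,v)\mapsto\varphi(u^{-1}v)$ is a positive definite kernel on $L$; a kernel $k$ on a set $X$ is called positive definite if $\sum_{i,j}k(x_i,x_j)c_i\overline{c_j}\ge 0$ for all finite families $x_i\in X$, $c_i\in\mathbb C$. Let $\mathbb S^d$ be the unit sphere of $\mathbb R^{d+1}$, and let $\mathcal P(\mathbb S^\infty,L)$ be the set of continuous functions $f:[-1,1]\times L\to\mathbb C$ such that for every integer $d\ge 1$ the kernel $((\xi,u),(\eta,v))\mapsto f(\xi\cdot\eta,u^{-1}v)$ is positive definite on $\mathbb S^d\times L$. Let $c_n(d,x)=C_n^{(\lambda)}(x)/C_n^{(\lambda)}(1)$ with $\lambda=(d-1)/2$ for $d\ge2$, where $C_n^{(\lambda)}$ are the Gegenbauer polynomials, and let $c_n(1,x)=T_n(x)$ be the Chebyshev polynomials. Let $f\in\mathcal P(\mathbb S^\infty,L)$. For every $d\ge1$ there is a unique sequence $(\varphi_{n,d})_{n\ge0}$ in $\mathcal P(L)$ (the $d$-Schoenberg functions of $f$)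 with $\sum_n\varphi_{n,d}(e)<\infty$ and $$f(x,u)=\sum_{n=0}^\infty\varphi_{n,d}(u)\,c_n(d,x),\qquad x\in[-1,1],\ u\in L.$$ For every $u\in L$ the function $f(\cdot,u)$ is $C^\infty$ on $]-1,1[$, and for every $n\ge0$ $$\lim_{d\to\infty}\varphi_{n,d}(u)=\varphi_n(u):=\frac1{n!}\frac{\partial^nf(0,u)}{\partial x^n}$$ uniformly for $u$ in compact subsets of $L$. The functions $\varphi_n$, $n\ge 0$, belong to $\mathcal P(L)$, and $(\varphi_n)_{n\ge0}$ is the unique sequence in $\mathcal P(L)$ with $\sum_n\varphi_n(e)<\infty$ and $$f(x,u)=\sum_{n=0}^\infty\varphi_n(u)\,x^n,\qquad x\in[-1,1],\ u\in L;$$ this series converges uniformly on $[-1,1]\times L$. -/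

import Mathlib

open Set Filter Topology
open scoped ComplexOrder ContDiff

/-- A kernel `k : X × X → ℂ` is positive definite if all the sums `∑ k(x_i, x_j) c_i \bar{c_j}`
are real and nonnegative (this is what `0 ≤ ·` means in `ℂ`). -/
def IsPosDefKernel {X : Type*} (k : X → X → ℂ) : Prop :=
  ∀ (N : ℕ) (x : Fin N → X) (c : Fin N → ℂ),
    0 ≤ ∑ i, ∑ j, k (x i) (x j) * c i * star (c j)

/-- The set `𝒫(L)` of continuous positive definite functions on the group `L`. -/
def PosDefGroup (L : Type*) [Group L] [TopologicalSpace L] : Set (L → ℂ) :=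
  {φ | Continuous φ ∧ IsPosDefKernel fun u v : L => φ (u⁻¹ * v)}

/-- The unit sphere `𝕊^d` of `ℝ^{d+1}`. -/
abbrev UnitSphere (d : ℕ) : Type :=
  Metric.sphere (0 : EuclideanSpace ℝ (Fin (d + 1))) 1

/-- The set `𝒫(𝕊^d, L)`. A function on `[-1,1] × L` is represented by a function on `ℝ × L`
of which only the values on `[-1,1] × L` matter. -/
def PosDefSphere (d : ℕ) (L : Type*) [Group L] [TopologicalSpace L] : Set (ℝ × L → ℂ) :=
  {f | ContinuousOn f (Icc (-1) 1 ×ˢ univ) ∧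
    IsPosDefKernel fun p q : UnitSphere d × L =>
      f (inner ℝ (p.1 : EuclideanSpace ℝ (Fin (d + 1))) q.1, p.2⁻¹ * q.2)}

/-- The set `𝒫(𝕊^∞, L)`, the intersection of all `𝒫(𝕊^d, L)` with `d ≥ 1`. -/
def PosDefSphereInfty (L : Type*) [Group L] [TopologicalSpace L] : Set (ℝ × L → ℂ) :=
  ⋂ (d : ℕ) (_ : 1 ≤ d), PosDefSphere d L

/-- The Gegenbauer polynomials `C_n^{(a)}(x)`, by their three-term recurrence
`(n + 2) C_{n+2} = 2 (n + 1 + a) x C_{n+1} - (n + 2 a) C_n`. -/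
noncomputable def gegenbauerC (a : ℝ) : ℕ → ℝ → ℝ
  | 0, _ => 1
  | 1, x => 2 * a * x
  | n + 2, x =>
      (2 * ((n : ℝ) + 1 + a) * x * gegenbauerC a (n + 1) x
        - ((n : ℝ) + 2 * a) * gegenbauerC a n x) / ((n : ℝ) + 2)

/-- The normalized ultraspherical polynomials `c_n(d, x)`: the Chebyshev polynomials `T_n(x)` for
`d = 1`, and `C_n^{(a)}(x) / C_n^{(a)}(1)` with `a = (d - 1) / 2` for `d ≥ 2`. -/
noncomputable def ultraspherical (n d : ℕ) (x : ℝ) : ℝ :=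
  if d = 1 then (Polynomial.Chebyshev.T ℝ (n : ℤ)).eval x
  else gegenbauerC (((d : ℝ) - 1) / 2) n x / gegenbauerC (((d : ℝ) - 1) / 2) n 1

/-- `φ` is the sequence of `d`-Schoenberg functions associated to `f`: all `φ n` are in `𝒫(L)`,
`∑ φ n (e) < ∞`, and `f(x, u) = ∑ φ n (u) c_n(d, x)` on `[-1,1] × L`. -/
def IsSchoenbergSequence {L : Type*} [Group L] [TopologicalSpace L]
    (d : ℕ) (f : ℝ × L → ℂ) (φ : ℕ → L → ℂ) : Prop :=
  (∀ n, φ n ∈ PosDefGroup L) ∧ Summable (fun n => φ n 1) ∧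
    ∀ x ∈ Icc (-1 : ℝ) 1, ∀ u : L,
      HasSum (fun n => φ n u * (ultraspherical n d x : ℂ)) (f (x, u))

/-- `φ` is the coefficient sequence of the power series expansion of `f`: all `φ n` are in `𝒫(L)`,
`∑ φ n (e) < ∞`, and `f(x, u) = ∑ φ n (u) x ^ n` on `[-1,1] × L`. -/
def IsPowerSequence {L : Type*} [Group L] [TopologicalSpace L]
    (f : ℝ × L → ℂ) (φ : ℕ → L → ℂ) : Prop :=
  (∀ n, φ n ∈ PosDefGroup L) ∧ Summable (fun n => φ n 1) ∧
    ∀ x ∈ Icc (-1 : ℝ) 1, ∀ u : L,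
      HasSum (fun n => φ n u * (x : ℂ) ^ n) (f (x, u))

/-- The function `u ↦ (1 / n!) ∂ⁿf(0, u) / ∂xⁿ`. -/
noncomputable def taylorCoeff {L : Type*} (f : ℝ × L → ℂ) (n : ℕ) (u : L) : ℂ :=
  (1 / (n.factorial : ℂ)) * iteratedDeriv n (fun x : ℝ => f (x, u)) 0

/-! Everything follows from one expansion `f(x,u) = ∑ φ_n(u) x^n` with positive definite `φ_n` and
`∑ φ_n(e) < ∞`.

To find it, restrict `f` to the vertices of the cube inscribed in `𝕊^d`. Their inner products are
means of signs, so `f` becomes a positive definite function on `{±1}^{d+1} × L`, and its Walsh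
coefficients are positive definite on `L` (`isPosDefKernel_walshCoeff`). Summing those of order `n`
gives the coefficient of `x^n` in the Bernstein polynomial of degree `d + 1` of `f(·,u)`. Bernstein
polynomials converge to `f`, and a limit of their coefficients gives the `φ_n`
(`exists_isPowerSequence`). A power series determines its coefficients, so they are the Taylor
coefficients.

For fixed `d`, each `x^k` is a convex combination of the `c_n(d,x)`; substituting this into the
power series produces the Schoenberg functions. They are unique by orthogonality and the bound
`|c_n(d,x)| ≤ 1`. As `d → ∞` the weight of `c_n(d,·)` in `x^k` tends to `1` if `k = n` and to `0`
otherwise (`tendsto_connectionCoeff`), so dominated convergence with majorant `φ_k(e)` gives the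
limit, uniformly on `L`. -/

/-! ### Closure properties of positive definite kernels. -/

section PosDefKernel

variable {X : Type*}

lemma IsPosDefKernel.sum_nonneg {k : X → X → ℂ} (hk : IsPosDefKernel k) {ι : Type*} [Fintype ι]
    (x : ι → X) (c : ι → ℂ) : 0 ≤ ∑ i, ∑ j, k (x i) (x j) * c i * star (c j) := by
  let e := (Fintype.equivFin ι).symm
  have h := hk (Fintype.card ι) (x ∘ e) (c ∘ e)
  rw [← Equiv.sum_comp e]
  simp_rw [← Equiv.sum_comp e (fun j => k (x _) (x j) * c _ * star (c j))]
  exact h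

lemma IsPosDefKernel.of_tendsto {β : Type*} {F : Filter β} [F.NeBot] {k : β → X → X → ℂ}
    {k' : X → X → ℂ} (hk : ∀ᶠ b in F, IsPosDefKernel (k b))
    (h : ∀ x y, Tendsto (fun b => k b x y) F (𝓝 (k' x y))) : IsPosDefKernel k' := by
  intro N x c
  refine ge_of_tendsto (tendsto_finsetSum _ fun i _ => tendsto_finsetSum _ fun j _ =>
    ((h (x i) (x j)).mul_const (c i)).mul_const (star (c j))) ?_
  filter_upwards [hk] with b hb using hb N x c

lemma IsPosDefKernel.sum {β : Type*} {k : β → X → X → ℂ} (s : Finset β)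
    (hk : ∀ b ∈ s, IsPosDefKernel (k b)) : IsPosDefKernel fun x y => ∑ b ∈ s, k b x y := by
  intro N x c
  have h : ∑ i, ∑ j, (∑ b ∈ s, k b (x i) (x j)) * c i * star (c j)
      = ∑ b ∈ s, ∑ i, ∑ j, k b (x i) (x j) * c i * star (c j) := by
    rw [Finset.sum_comm' (t' := Finset.univ) (s' := fun _ => s) (by simp)]
    refine Finset.sum_congr rfl fun i _ => ?_
    rw [Finset.sum_comm' (t' := Finset.univ) (s' := fun _ => s) (by simp)]
    refine Finset.sum_congr rfl fun j _ => ?_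
    rw [Finset.sum_mul, Finset.sum_mul]
  rw [h]
  exact Finset.sum_nonneg fun b hb => hk b hb N x c

lemma IsPosDefKernel.mul_const {k : X → X → ℂ} (hk : IsPosDefKernel k) {a : ℂ} (ha : 0 ≤ a) :
    IsPosDefKernel fun x y => k x y * a := by
  intro N x c
  have h : ∑ i, ∑ j, k (x i) (x j) * a * c i * star (c j)
      = (∑ i, ∑ j, k (x i) (x j) * c i * star (c j)) * a := by
    simp_rw [Finset.sum_mul]
    exact Finset.sum_congr rfl fun i _ => Finset.sum_congr rfl fun j _ => by ring
  rw [h]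
  exact mul_nonneg (hk N x c) ha

lemma IsPosDefKernel.tsum {β : Type*} {k : β → X → X → ℂ} (hk : ∀ b, IsPosDefKernel (k b))
    (hs : ∀ x y, Summable fun b => k b x y) : IsPosDefKernel fun x y => ∑' b, k b x y :=
  .of_tendsto (F := atTop) (.of_forall fun s : Finset β => .sum s fun b _ => hk b)
    fun x y => (hs x y).hasSum

end PosDefKernel

/-! ### Elementary inequalities for positive definite functions on a group. -/

section PosDefFunction

variable {L : Type*} [Group L] {φ : L → ℂ}

lemma IsPosDefKernel.apply_one_nonneg (hφ : IsPosDefKernel fun u v : L => φ (u⁻¹ * v)) :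
    0 ≤ φ 1 := by
  simpa using hφ 1 (fun _ => 1) (fun _ => 1)

lemma IsPosDefKernel.apply_inv (hφ : IsPosDefKernel fun u v : L => φ (u⁻¹ * v)) (u : L) :
    φ u⁻¹ = star (φ u) := by
  have h1 := hφ.apply_one_nonneg
  -- Only the reality of the two forms is used: weights `(1, 1)` compare the imaginary parts of `φ
  -- u` and `φ u⁻¹`, weights `(1, i)` the real parts.
  have h2 := hφ 2 ![1, u] ![1, 1]
  have h3 := hφ 2 ![1, u] ![1, Complex.I]
  simp [Fin.sum_univ_two, Complex.le_def] at h1 h2 h3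
  apply Complex.ext <;> simp <;> linarith [h1.2, h2.2, h3.2]

lemma IsPosDefKernel.norm_le (hφ : IsPosDefKernel fun u v : L => φ (u⁻¹ * v)) (u : L) :
    ‖φ u‖ ≤ (φ 1).re := by
  have h1 := hφ.apply_one_nonneg
  rcases eq_or_ne (φ u) 0 with h0 | h0
  · simpa [h0] using (Complex.le_def.1 h1).1
  -- The phase of the second weight turns each cross term into `-‖φ u‖`.
  have h2 := hφ 2 ![1, u] ![1, -(φ u / ‖φ u‖)]
  have hn : (‖φ u‖ : ℂ) ≠ 0 := by simpa using h0
  have hm : φ u * star (φ u) = (‖φ u‖ : ℂ) ^ 2 := by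
    simpa using Complex.mul_conj' (φ u)
  have e : ∑ i, ∑ j, φ ((![1, u] i)⁻¹ * ![1, u] j) * ![1, -(φ u / ‖φ u‖)] i
      * star (![1, -(φ u / ‖φ u‖)] j) = 2 * φ 1 - 2 * (‖φ u‖ : ℂ) := by
    simp only [Fin.sum_univ_two, Matrix.cons_val_zero, Matrix.cons_val_one, inv_one, one_mul,
      mul_one, star_one, inv_mul_cancel, hφ.apply_inv u, star_neg, star_div₀]
    have hs : star (‖φ u‖ : ℂ) = ‖φ u‖ := by simp
    rw [hs]
    field_simp
    linear_combination (φ 1 - 2 * (‖φ u‖ : ℂ)) * hm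
  simp only [e] at h2
  have := (Complex.le_def.1 h2).1
  simp at this
  linarith

end PosDefFunction

/-! ### Walsh analysis on the inscribed cube, and Bernstein polynomials. -/

section Cube

/-- The vertex of the cube inscribed in the unit sphere with signs `ε`. -/
noncomputable def cubeVertex (d : ℕ) (ε : Fin (d + 1) → ℤˣ) : UnitSphere d :=
  ⟨WithLp.toLp 2 fun i => ((ε i : ℤ) : ℝ) / √(d + 1), by
    have h (i) : (((ε i : ℤ) : ℝ)) ^ 2 = 1 := by
      rcases Int.units_eq_one_or (ε i) with h | h <;> simp [h]
    have h0 : (0 : ℝ) ≤ d + 1 := by positivity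
    have h1 : (d + 1 : ℝ) ≠ 0 := by positivity
    simp [EuclideanSpace.norm_eq, div_pow, h, Real.sq_sqrt h0, h1]⟩

/-- The mean of the signs `ε`. -/
noncomputable def signMean (d : ℕ) (ε : Fin (d + 1) → ℤˣ) : ℝ :=
  (∑ i, ((ε i : ℤ) : ℝ)) / (d + 1)

lemma inner_cubeVertex (d : ℕ) (ε δ : Fin (d + 1) → ℤˣ) :
    inner ℝ (cubeVertex d ε : EuclideanSpace ℝ (Fin (d + 1))) (cubeVertex d δ)
      = signMean d (ε * δ) := by
  have h0 : (0 : ℝ) ≤ d + 1 := by positivity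
  simp only [cubeVertex, signMean, PiLp.inner_apply, Finset.sum_div]
  refine Finset.sum_congr rfl fun i _ => ?_
  simp only [inner, Pi.mul_apply, Units.val_mul, Int.cast_mul]
  simp
  rw [div_mul_div_comm, Real.mul_self_sqrt h0, mul_comm]

/-- The Walsh function of index `A`. -/
def walsh {ι : Type*} (A : Finset ι) (ε : ι → ℤˣ) : ℂ := ∏ i ∈ A, ((ε i : ℤ) : ℂ)

lemma walsh_mul {ι : Type*} (A : Finset ι) (ε δ : ι → ℤˣ) :
    walsh A (ε * δ) = walsh A ε * walsh A δ := by
  simp [walsh, Finset.prod_mul_distrib]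

lemma units_pi_mul_self {ι : Type*} (ε : ι → ℤˣ) : ε * ε = 1 :=
  funext fun i => Int.units_mul_self (ε i)

lemma star_walsh {ι : Type*} (A : Finset ι) (ε : ι → ℤˣ) : star (walsh A ε) = walsh A ε := by
  simp [walsh]

/-- The Walsh coefficient of `ε ↦ f (mean of ε, u)`. -/
noncomputable def walshCoeff {L : Type*} (f : ℝ × L → ℂ) (d : ℕ) (A : Finset (Fin (d + 1)))
    (u : L) : ℂ :=
  ∑ ε : Fin (d + 1) → ℤˣ, f (signMean d ε, u) * walsh A ε * (2⁻¹ : ℂ) ^ (d + 1)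

/-- Projection onto a character of `{±1}^{d+1}`: test `f` on all pairs (vertex, `x i`) with weights
`walsh A ε * c i`. After the substitution `δ ↦ εδ` the sum over `δ` no longer depends on `ε`, so the
whole form is a positive multiple of the wanted one. -/
lemma isPosDefKernel_walshCoeff {L : Type*} [Group L] [TopologicalSpace L] {f : ℝ × L → ℂ} {d : ℕ}
    (hf : f ∈ PosDefSphere d L) (A : Finset (Fin (d + 1))) :
    IsPosDefKernel fun u v : L => walshCoeff f d A (u⁻¹ * v) := by
  intro N x c
  have h := hf.2.sum_nonneg (ι := (Fin (d + 1) → ℤˣ) × Fin N) (fun p => (cubeVertex d p.1, x p.2))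
    (fun p => walsh A p.1 * c p.2)
  simp only [inner_cubeVertex, Fintype.sum_prod_type] at h
  have key : ∀ ε : Fin (d + 1) → ℤˣ, ∑ i, ∑ δ : Fin (d + 1) → ℤˣ, ∑ j,
      f (signMean d (ε * δ), (x i)⁻¹ * x j) * (walsh A ε * c i) * star (walsh A δ * c j)
      = 2 ^ (d + 1) * ∑ i, ∑ j, walshCoeff f d A ((x i)⁻¹ * x j) * c i * star (c j) := by
    intro ε
    rw [Finset.mul_sum]
    refine Finset.sum_congr rfl fun i _ => ?_
    rw [Finset.sum_comm, Finset.mul_sum]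
    refine Finset.sum_congr rfl fun j _ => ?_
    rw [walshCoeff, ← Equiv.sum_comp (Equiv.mulLeft ε), Finset.sum_mul, Finset.sum_mul,
      Finset.mul_sum]
    refine Finset.sum_congr rfl fun δ _ => ?_
    have e1 : ε * (ε * δ) = δ := by
      rw [← mul_assoc, units_pi_mul_self, one_mul]
    have e2 : walsh A ε * walsh A ε = 1 := by
      rw [← walsh_mul, units_pi_mul_self]; simp [walsh]
    simp only [Equiv.coe_mulLeft, e1, star_mul', star_walsh, walsh_mul, inv_pow]
    field_simp
    linear_combination f (signMean d δ, (x i)⁻¹ * x j) * c i * walsh A δ * star (c j) * e2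
  simp_rw [key] at h
  simp only [Finset.sum_const, nsmul_eq_mul, Finset.card_univ] at h
  rw [← mul_assoc] at h
  have hc : (0 : ℂ) < (Fintype.card (Fin (d + 1) → ℤˣ) : ℂ) * 2 ^ (d + 1) := by
    have : 0 < Fintype.card (Fin (d + 1) → ℤˣ) := Fintype.card_pos
    positivity
  have h' := mul_nonneg (inv_nonneg.2 hc.le) h
  rwa [inv_mul_cancel_left₀ hc.ne'] at h'

lemma sum_walshCoeff_mul_pow {L : Type*} (f : ℝ × L → ℂ) (d : ℕ) (u : L) (x : ℂ) :
    ∑ A, walshCoeff f d A u * x ^ A.card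
      = ∑ ε : Fin (d + 1) → ℤˣ, f (signMean d ε, u) * ∏ i, (1 + (ε i : ℤ) * x) / 2 := by
  simp_rw [walshCoeff, Finset.sum_mul]
  rw [Finset.sum_comm]
  refine Finset.sum_congr rfl fun ε _ => ?_
  rw [Finset.prod_div_distrib, Finset.prod_one_add, Finset.sum_div, Finset.mul_sum]
  simp only [Finset.powerset_univ]
  refine Finset.sum_congr rfl fun A _ => ?_
  simp [walsh, Finset.prod_mul_distrib]
  field_simp

/-- Group the sign vectors by their number `k` of entries `+1`: the right side is the Bernstein
polynomial of degree `d + 1`, carried from `[0,1]` to `[-1,1]`. -/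
lemma sum_signs_eq (d : ℕ) (h : ℝ → ℂ) (x : ℂ) :
    ∑ ε : Fin (d + 1) → ℤˣ, h (signMean d ε) * ∏ i, (1 + (ε i : ℤ) * x) / 2
      = ∑ k ∈ Finset.range (d + 2), ((d + 1).choose k : ℂ) * ((1 + x) / 2) ^ k
          * ((1 - x) / 2) ^ (d + 1 - k) * h (2 * (k / (d + 1)) - 1) := by
  classical
  let s : Finset (Fin (d + 1)) → Fin (d + 1) → ℤˣ := fun S i => if i ∈ S then 1 else -1
  have hs : Function.Bijective s := by
    refine ⟨fun S T hST => ?_, fun ε => ⟨Finset.univ.filter fun i => ε i = 1, ?_⟩⟩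
    · ext i
      have := congrFun hST i
      by_cases h1 : i ∈ S <;> by_cases h2 : i ∈ T <;> simp_all [s]
    · ext i
      rcases Int.units_eq_one_or (ε i) with h | h <;> simp [s, h]
  rw [← hs.sum_comp]
  have hp (S : Finset (Fin (d + 1))) : ∏ i, (1 + (s S i : ℤ) * x) / 2
      = ((1 + x) / 2) ^ S.card * ((1 - x) / 2) ^ (d + 1 - S.card) := by
    have : ∀ i, (1 + (s S i : ℤ) * x) / 2 = if i ∈ S then (1 + x) / 2 else (1 - x) / 2 := by
      intro i
      by_cases h : i ∈ S <;> simp [s, h, sub_eq_add_neg]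
    simp_rw [this]
    rw [Finset.prod_ite]
    simp only [Finset.filter_not, ← Finset.compl_eq_univ_sdiff, Finset.prod_const,
      Finset.card_compl, Finset.filter_univ_mem, Fintype.card_fin]
  have hm (S : Finset (Fin (d + 1))) : signMean d (s S) = 2 * (S.card / (d + 1)) - 1 := by
    have : ∀ i, ((s S i : ℤ) : ℝ) = 2 * (if i ∈ S then 1 else 0) - 1 := by
      intro i
      by_cases h : i ∈ S <;> simp [s, h]; norm_num
    have h1 : (d + 1 : ℝ) ≠ 0 := by positivity
    simp only [signMean, this, Finset.sum_sub_distrib, ← Finset.mul_sum]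
    simp
    field_simp
  simp_rw [hp, hm]
  rw [← Finset.powerset_univ, Finset.sum_powerset_apply_card (fun k : ℕ =>
    h (2 * (k / (d + 1)) - 1) * (((1 + x) / 2) ^ k * ((1 - x) / 2) ^ (d + 1 - k)))]
  simp only [Finset.card_univ, Fintype.card_fin, nsmul_eq_mul]
  exact Finset.sum_congr rfl fun k _ => by ring

lemma tendsto_sum_walshCoeff_mul_pow {L : Type*} (f : ℝ × L → ℂ) (u : L)
    (hf : ContinuousOn (fun x => f (x, u)) (Icc (-1) 1)) {x : ℝ} (hx : x ∈ Icc (-1 : ℝ) 1) :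
    Tendsto (fun d => ∑ A, walshCoeff f d A u * (x : ℂ) ^ A.card) atTop (𝓝 (f (x, u))) := by
  let g : C(unitInterval, ℂ) := ⟨fun y => f (2 * y - 1, u), by
    refine hf.comp_continuous (by fun_prop) fun y => ?_
    constructor <;> linarith [y.2.1, y.2.2]⟩
  let y : unitInterval := ⟨(1 + x) / 2, by constructor <;> linarith [hx.1, hx.2]⟩
  have h := ((ContinuousEvalConst.continuous_eval_const y).tendsto g).comp
    ((bernsteinApproximation_uniform g).comp (tendsto_add_atTop_nat 1))
  have e : g y = f (x, u) := by
    change f (2 * ((1 + x) / 2) - 1, u) = _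
    congr 2; ring
  rw [e] at h
  refine h.congr fun d => ?_
  rw [sum_walshCoeff_mul_pow, sum_signs_eq d (fun t => f (t, u))]
  simp only [Function.comp_apply, bernsteinApproximation.apply]
  rw [Finset.sum_range]
  refine Finset.sum_congr rfl fun k _ => ?_
  rw [bernstein_apply]
  have e1 : (1 - (1 + (x : ℂ)) / 2) = (1 - x) / 2 := by ring
  simp [g, y, bernstein.z, e1]

end Cube

/-! ### Positive definiteness of the Bernstein coefficients. -/

section BernsteinCoeff

variable {L : Type*}

/-- The coefficient of `x ^ n` in the Bernstein polynomial of degree `d + 1` of `f (·, u)`. -/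
noncomputable def bernsteinCoeff (f : ℝ × L → ℂ) (d n : ℕ) (u : L) : ℂ :=
  ∑ A ∈ Finset.powersetCard n (Finset.univ : Finset (Fin (d + 1))), walshCoeff f d A u

lemma isPosDefKernel_bernsteinCoeff [Group L] [TopologicalSpace L] {f : ℝ × L → ℂ} {d : ℕ}
    (hf : f ∈ PosDefSphere d L) (n : ℕ) :
    IsPosDefKernel fun u v : L => bernsteinCoeff f d n (u⁻¹ * v) :=
  .sum _ fun A _ => isPosDefKernel_walshCoeff hf A

lemma hasSum_bernsteinCoeff (f : ℝ × L → ℂ) (d : ℕ) (u : L) (x : ℂ) :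
    HasSum (fun n => bernsteinCoeff f d n u * x ^ n) (∑ A, walshCoeff f d A u * x ^ A.card) := by
  have h : ∑ A, walshCoeff f d A u * x ^ A.card
      = ∑ n ∈ Finset.range (d + 2), bernsteinCoeff f d n u * x ^ n := by
    rw [← Finset.powerset_univ, Finset.sum_powerset]
    simp only [Finset.card_univ, Fintype.card_fin, bernsteinCoeff, Finset.sum_mul]
    refine Finset.sum_congr rfl fun n _ => Finset.sum_congr rfl fun A hA => ?_
    rw [(Finset.mem_powersetCard.1 hA).2]
  rw [h]
  apply hasSum_sum_of_ne_finset_zero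
  intro n hn
  rw [bernsteinCoeff, Finset.powersetCard_eq_empty.2, Finset.sum_empty, zero_mul]
  have := mt Finset.mem_range.2 hn
  rw [Finset.card_univ, Fintype.card_fin]
  omega

end BernsteinCoeff

lemma ofReal_re_of_nonneg {z : ℂ} (hz : 0 ≤ z) : (z.re : ℂ) = z :=
  Complex.ext rfl (by simpa using (Complex.le_def.1 hz).2)

lemma PosDefSphere.continuousOn_left {L : Type*} [Group L] [TopologicalSpace L] {d : ℕ}
    {f : ℝ × L → ℂ} (hf : f ∈ PosDefSphere d L) (u : L) :
    ContinuousOn (fun x => f (x, u)) (Icc (-1) 1) :=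
  hf.1.comp (by fun_prop) fun _ hx => ⟨hx, mem_univ _⟩

lemma PosDefSphere.continuous_right {L : Type*} [Group L] [TopologicalSpace L] {d : ℕ}
    {f : ℝ × L → ℂ} (hf : f ∈ PosDefSphere d L) {x : ℝ} (hx : x ∈ Icc (-1 : ℝ) 1) :
    Continuous fun u => f (x, u) :=
  hf.1.comp_continuous (by fun_prop) fun _ => ⟨hx, mem_univ _⟩

lemma norm_mul_pow_le_of_mem_Icc {z : ℂ} {b x : ℝ} (hz : ‖z‖ ≤ b) (hx : x ∈ Icc (-1 : ℝ) 1)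
    (n : ℕ) : ‖z * (x : ℂ) ^ n‖ ≤ b := by
  rw [norm_mul, norm_pow, Complex.norm_real, Real.norm_eq_abs]
  calc ‖z‖ * |x| ^ n ≤ ‖z‖ * 1 := by
        gcongr
        exact pow_le_one₀ (abs_nonneg x) (abs_le.2 hx)
    _ ≤ b := by simpa using hz

/-- Pointwise limits of coefficients need not be continuous, so continuity is recovered from the
sum. The shifted series `T m x` tends to `φ m` as `x → 0`, uniformly in `u` since the error is at
most `|x| ∑ b`. Continuity passes from `T m x` to `T (m + 1) x` by subtracting `φ m` and dividing by
`x ≠ 0`. -/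
lemma continuous_coeff_of_continuous_tsum {X : Type*} [TopologicalSpace X] {φ : ℕ → X → ℂ}
    {b : ℕ → ℝ} (hb : Summable b) (hφ : ∀ n u, ‖φ n u‖ ≤ b n)
    (hc : ∀ x ∈ Icc (-1 : ℝ) 1, Continuous fun u => ∑' n, φ n u * (x : ℂ) ^ n) (n : ℕ) :
    Continuous (φ n) := by
  set T : ℕ → ℝ → X → ℂ := fun m x u => ∑' k, φ (k + m) u * (x : ℂ) ^ k with hT
  have hs (m : ℕ) (x : ℝ) (hx : x ∈ Icc (-1 : ℝ) 1) (u : X) :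
      Summable fun k => φ (k + m) u * (x : ℂ) ^ k :=
    .of_norm_bounded ((summable_nat_add_iff m).2 hb)
      fun k => norm_mul_pow_le_of_mem_Icc (hφ _ u) hx k
  have hbound (m : ℕ) (x : ℝ) (hx : x ∈ Icc (-1 : ℝ) 1) (u : X) :
      ‖T m x u‖ ≤ ∑' k, b (k + m) :=
    tsum_of_norm_bounded ((summable_nat_add_iff m).2 hb).hasSum
      fun k => norm_mul_pow_le_of_mem_Icc (hφ _ u) hx k
  have hrec (m : ℕ) (x : ℝ) (hx : x ∈ Icc (-1 : ℝ) 1) (u : X) :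
      T m x u = φ m u + x * T (m + 1) x u := by
    simp only [hT]
    rw [(hs m x hx u).tsum_eq_zero_add, ← tsum_mul_left]
    simp only [zero_add, pow_zero, mul_one]
    congr 2
    ext k
    rw [show k + 1 + m = k + (m + 1) by ring]
    ring
  have hsmall : ∀ᶠ x in 𝓝[≠] (0 : ℝ), x ∈ Icc (-1 : ℝ) 1 ∧ x ≠ 0 :=
    (eventually_nhdsWithin_of_eventually_nhds (Icc_mem_nhds (by norm_num) (by norm_num))).and
      eventually_mem_nhdsWithin
  have hcoef (m : ℕ) (h : ∀ x ∈ Icc (-1 : ℝ) 1, x ≠ 0 → Continuous (T m x)) :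
      Continuous (φ m) := by
    refine TendstoUniformly.continuous (F := T m) (p := 𝓝[≠] (0 : ℝ)) ?_
      (hsmall.mono fun x hx => h x hx.1 hx.2).frequently
    rw [Metric.tendstoUniformly_iff]
    intro ε hε
    have hlim : Tendsto (fun x : ℝ => |x| * ∑' k, b (k + (m + 1))) (𝓝[≠] 0) (𝓝 0) := by
      refine tendsto_nhdsWithin_of_tendsto_nhds ?_
      exact (by fun_prop : Continuous fun x : ℝ => |x| * ∑' k, b (k + (m + 1))).tendsto' 0 0
        (by simp)
    filter_upwards [hsmall, hlim.eventually (gt_mem_nhds hε)] with x hx hx' u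
    rw [dist_eq_norm, hrec m x hx.1, sub_add_cancel_left, norm_neg, norm_mul, Complex.norm_real,
      Real.norm_eq_abs]
    exact (mul_le_mul_of_nonneg_left (hbound _ x hx.1 u) (abs_nonneg x)).trans_lt hx'
  refine hcoef n ?_
  induction n with
  | zero => exact fun x hx _ => by simpa [hT] using hc x hx
  | succ n ih =>
    intro x hx hx0
    have h : T (n + 1) x = fun u => (T n x u - φ n u) / x := by
      ext u
      rw [hrec n x hx]
      field_simp
      ring
    rw [h]
    exact ((ih x hx hx0).sub (hcoef n ih)).div_const _

/-! ### The power series expansion: existence, uniqueness, smoothness. -/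

section PowerSequence

variable {L : Type*} [Group L] [TopologicalSpace L] {f : ℝ × L → ℂ}

/-- A continuous function which is positive definite on all `𝕊^d × L` has a power series
expansion with coefficients in `𝒫(L)`. -/
lemma exists_isPowerSequence (hf : f ∈ PosDefSphereInfty L) : ∃ φ, IsPowerSequence f φ := by
  have hd (d : ℕ) : f ∈ PosDefSphere (d + 1) L := by
    simp only [PosDefSphereInfty, mem_iInter] at hf
    exact hf (d + 1) (by omega)
  set c : ℕ → ℕ → L → ℂ := fun d n u => bernsteinCoeff f (d + 1) n u with hc
  have hcpd (d n : ℕ) : IsPosDefKernel fun u v : L => c d n (u⁻¹ * v) :=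
    isPosDefKernel_bernsteinCoeff (hd d) n
  have hcsum (d : ℕ) (u : L) (x : ℂ) := hasSum_bernsteinCoeff f (d + 1) u x
  have hclim (u : L) {x : ℝ} (hx : x ∈ Icc (-1 : ℝ) 1) :=
    (tendsto_sum_walshCoeff_mul_pow f u (PosDefSphere.continuousOn_left (hd 0) u) hx).comp
      (tendsto_add_atTop_nat 1)
  -- At `x = 1`, `u = e` the coefficients are nonnegative and sum to the Bernstein value, which
  -- converges in `d` and hence is bounded.
  obtain ⟨M, hM⟩ : ∃ M : ℝ, ∀ d (s : Finset ℕ), ∑ n ∈ s, (c d n 1).re ≤ M := by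
    have h := ((Complex.continuous_re.tendsto _).comp
      (hclim 1 (show (1 : ℝ) ∈ Icc (-1 : ℝ) 1 by norm_num))).bddAbove_range
    obtain ⟨M, hM⟩ := h
    refine ⟨M, fun d s => le_trans ?_ (hM ⟨d, rfl⟩)⟩
    have h1 := Complex.hasSum_re (hcsum d 1 ((1 : ℝ) : ℂ))
    simp only [Complex.ofReal_one, one_pow, mul_one] at h1
    simp only [Function.comp_apply, Complex.ofReal_one, one_pow, mul_one]
    exact sum_le_hasSum s (fun n _ => (Complex.le_def.1 (hcpd d n).apply_one_nonneg).1) h1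
  have hcM (d n : ℕ) (u : L) : ‖c d n u‖ ≤ M :=
    ((hcpd d n).norm_le u).trans (by simpa using hM d {n})
  -- A fixed ultrafilter gives limits for all `n` and all `u` at once, where a diagonal subsequence
  -- would need countability of `L`.
  have hex (n : ℕ) (u : L) : ∃ l, Tendsto (fun d => c d n u) (hyperfilter ℕ) (𝓝 l) := by
    obtain ⟨l, -, hl⟩ := (isCompact_closedBall (0 : ℂ) M).ultrafilter_le_nhds
      ((hyperfilter ℕ).map fun d => c d n u) (by
        rw [le_principal_iff]
        exact Filter.mem_map.2 (univ_mem' fun d : ℕ => mem_closedBall_zero_iff.2 (hcM d n u)))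
    exact ⟨l, hl⟩
  choose φ hφ using hex
  have hU : (hyperfilter ℕ : Filter ℕ) ≤ atTop := by
    rw [← Nat.cofinite_eq_atTop]; exact hyperfilter_le_cofinite
  have hpd (n : ℕ) : IsPosDefKernel fun u v : L => φ n (u⁻¹ * v) :=
    .of_tendsto (.of_forall fun d => hcpd d n) fun u v => hφ n (u⁻¹ * v)
  have hsr : Summable fun n => (φ n 1).re := by
    refine summable_of_sum_le (c := M)
      (fun n => (Complex.le_def.1 (hpd n).apply_one_nonneg).1) fun s => ?_
    refine le_of_tendsto (tendsto_finsetSum s fun n _ =>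
      (Complex.continuous_re.tendsto _).comp (hφ n 1)) (.of_forall fun d => ?_)
    exact hM d s
  have hs : Summable fun n => φ n 1 := by
    convert Complex.ofRealCLM.summable hsr with n
    exact (ofReal_re_of_nonneg (hpd n).apply_one_nonneg).symm
  have hsx (u : L) (x : ℝ) (hx : x ∈ Icc (-1 : ℝ) 1) : Summable fun n => φ n u * (x : ℂ) ^ n :=
    .of_norm_bounded hsr fun n => norm_mul_pow_le_of_mem_Icc ((hpd n).norm_le u) hx n
  -- The geometric majorant `M |x|^n` is summable only in the open interval; the endpoints follow by
  -- continuity of both sides.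
  have hinner (u : L) (x : ℝ) (hx : x ∈ Ioo (-1 : ℝ) 1) :
      ∑' n, φ n u * (x : ℂ) ^ n = f (x, u) := by
    have h1 : Tendsto (fun d => ∑' n, c d n u * (x : ℂ) ^ n) (hyperfilter ℕ)
        (𝓝 (∑' n, φ n u * (x : ℂ) ^ n)) := by
      refine tendsto_tsum_of_dominated_convergence (bound := fun n => M * |x| ^ n) ?_
        (fun n => (hφ n u).mul_const _) (.of_forall fun d n => ?_)
      · exact (summable_geometric_of_lt_one (abs_nonneg x) (abs_lt.2 hx)).mul_left M
      · rw [norm_mul, norm_pow, Complex.norm_real, Real.norm_eq_abs]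
        exact mul_le_mul_of_nonneg_right (hcM d n u) (by positivity)
    have h2 := (hclim u (Ioo_subset_Icc_self hx)).mono_left hU
    refine tendsto_nhds_unique h1 (h2.congr fun d => ?_)
    exact (hcsum d u x).tsum_eq.symm
  have heq (u : L) (x : ℝ) (hx : x ∈ Icc (-1 : ℝ) 1) :
      ∑' n, φ n u * (x : ℂ) ^ n = f (x, u) := by
    refine EqOn.of_subset_closure (fun y hy => hinner u y hy) ?_
      (PosDefSphere.continuousOn_left (hd 0) u) Ioo_subset_Icc_self ?_ hx
    · exact continuousOn_tsum (fun n => by fun_prop) hsr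
        fun n y hy => norm_mul_pow_le_of_mem_Icc ((hpd n).norm_le u) hy n
    · rw [closure_Ioo (by norm_num)]
  refine ⟨φ, fun n => ⟨?_, hpd n⟩, hs, fun x hx u => heq u x hx ▸ (hsx u x hx).hasSum⟩
  refine continuous_coeff_of_continuous_tsum hsr (fun n u => (hpd n).norm_le u) (fun x hx => ?_) n
  simp_rw [heq _ x hx]
  exact PosDefSphere.continuous_right (hd 0) hx

variable {φ : ℕ → L → ℂ}

omit [TopologicalSpace L] in
lemma summable_re_apply_one (h : Summable fun n => φ n 1) : Summable fun n => (φ n 1).re :=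
  Complex.reCLM.summable h

lemma IsPowerSequence.hasFPowerSeriesOnBall (h : IsPowerSequence f φ) (u : L) :
    HasFPowerSeriesOnBall (fun x : ℝ => f (x, u))
      (fun n => ContinuousMultilinearMap.mkPiRing ℝ (Fin n) (φ n u)) 0 1 where
  r_le := by
    obtain ⟨M, hM⟩ := (summable_re_apply_one h.2.1).tendsto_atTop_zero.bddAbove_range
    refine FormalMultilinearSeries.le_radius_of_bound _ M (r := 1) fun n => ?_
    simp only [ContinuousMultilinearMap.norm_mkPiRing, NNReal.coe_one, one_pow, mul_one]
    exact ((h.1 n).2.norm_le u).trans (hM ⟨n, rfl⟩)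
  r_pos := one_pos
  hasSum := by
    intro y hy
    have hy' : y ∈ Icc (-1 : ℝ) 1 := by
      have : ‖y‖ < 1 := by simpa [← ENNReal.ofReal_one, Metric.eball_ofReal] using hy
      exact abs_le.1 this.le
    convert! h.2.2 y hy' u using 2 with n
    · simp [mul_comm]
    · rw [zero_add]

lemma IsPowerSequence.eq_taylorCoeff (h : IsPowerSequence f φ) : φ = taylorCoeff f := by
  ext n u
  have h1 := (h.hasFPowerSeriesOnBall u).factorial_smul 1 n
  simp at h1
  rw [taylorCoeff, iteratedDeriv_eq_iteratedFDeriv, ← h1]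
  have : (n.factorial : ℂ) ≠ 0 := by exact_mod_cast n.factorial_ne_zero
  field_simp

lemma IsPowerSequence.contDiffOn (h : IsPowerSequence f φ) (u : L) :
    ContDiffOn ℝ ∞ (fun x : ℝ => f (x, u)) (Ioo (-1) 1) := by
  have h1 := (h.hasFPowerSeriesOnBall u).analyticOnNhd
  refine (h1.mono fun x hx => ?_).analyticOn.contDiffOn (uniqueDiffOn_Ioo _ _)
  have : ‖x‖ < 1 := abs_lt.2 hx
  simpa [← ENNReal.ofReal_one, Metric.eball_ofReal] using this

lemma IsPowerSequence.tendstoUniformlyOn (h : IsPowerSequence f φ) :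
    TendstoUniformlyOn
      (fun (N : ℕ) (p : ℝ × L) => ∑ n ∈ Finset.range N, φ n p.2 * (p.1 : ℂ) ^ n)
      f atTop (Icc (-1) 1 ×ˢ univ) := by
  refine (tendstoUniformlyOn_tsum_nat (summable_re_apply_one h.2.1)
    fun n p hp => norm_mul_pow_le_of_mem_Icc ((h.1 n).2.norm_le p.2) hp.1 n).congr_right
    fun p hp => ?_
  exact (h.2.2 p.1 hp.1 p.2).tsum_eq

end PowerSequence

/-! ### Ultraspherical polynomials: differential equation, bound, orthogonality. -/

section UltrasphericalPoly

open Polynomial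

/-- The normalized ultraspherical polynomials for the sphere of dimension `e + 1`. -/
noncomputable def ultrasphericalPoly (e : ℕ) : ℕ → ℝ[X]
  | 0 => 1
  | 1 => X
  | n + 2 => C ((n + 1 + e : ℝ)⁻¹) * (C (2 * n + 2 + e : ℝ) * X * ultrasphericalPoly e (n + 1)
      - C (n + 1 : ℝ) * ultrasphericalPoly e n)

variable (e : ℕ)

local notation "P" => ultrasphericalPoly e

lemma ultrasphericalPoly_rec (n : ℕ) :
    ((n : ℝ[X]) + 1 + (e : ℝ[X])) * P (n + 2)
      = (2 * (n : ℝ[X]) + 2 + (e : ℝ[X])) * X * P (n + 1) - ((n : ℝ[X]) + 1) * P n := by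
  have h : ((n : ℝ[X]) + 1 + e) * C ((n + 1 + e : ℝ)⁻¹) = 1 := by
    have h0 : (n + 1 + e : ℝ) ≠ 0 := by positivity
    rw [show (n : ℝ[X]) + 1 + e = C (n + 1 + e : ℝ) by simp, ← C_mul, mul_inv_cancel₀ h0, C_1]
  rw [ultrasphericalPoly, ← mul_assoc, h]
  simp [C_ofNat]

lemma ultrasphericalPoly_eval_rec (n : ℕ) (x : ℝ) :
    ((n : ℝ) + 1 + e) * (P (n + 2)).eval x
      = (2 * n + 2 + e) * x * (P (n + 1)).eval x - (n + 1) * (P n).eval x := by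
  simpa using congrArg (eval x) (ultrasphericalPoly_rec e n)

lemma ultrasphericalPoly_eval_one (n : ℕ) : (P n).eval 1 = 1 := by
  induction n using Nat.twoStepInduction with
  | zero => simp [ultrasphericalPoly]
  | one => simp [ultrasphericalPoly]
  | more n h0 h1 =>
    have h := ultrasphericalPoly_eval_rec e n 1
    rw [h0, h1] at h
    have hn : (n + 1 + e : ℝ) ≠ 0 := by positivity
    exact mul_left_cancel₀ hn (by linear_combination h)

lemma ultrasphericalPoly_eval_neg_one (n : ℕ) : (P n).eval (-1) = (-1) ^ n := by
  induction n using Nat.twoStepInduction with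
  | zero => simp [ultrasphericalPoly]
  | one => simp [ultrasphericalPoly]
  | more n h0 h1 =>
    have h := ultrasphericalPoly_eval_rec e n (-1)
    rw [h0, h1] at h
    have hn : (n + 1 + e : ℝ) ≠ 0 := by positivity
    exact mul_left_cancel₀ hn (by linear_combination h)

/-- The two relations are proved together: differentiating the recurrence needs both at `n` to give
the first at `n + 1`, while the second at `n + 1` is the first at `n` plus the recurrence. -/
lemma ultrasphericalPoly_structure (n : ℕ) :
    (1 - X ^ 2) * derivative (P (n + 1)) = ((n : ℝ[X]) + 1) * (P n - X * P (n + 1)) ∧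
    (1 - X ^ 2) * derivative (P n) = ((n : ℝ[X]) + (e : ℝ[X])) * (X * P n - P (n + 1)) := by
  induction n with
  | zero => constructor <;> simp [ultrasphericalPoly]; ring
  | succ n ih =>
    obtain ⟨h1, h2⟩ := ih
    have hr := ultrasphericalPoly_rec e n
    constructor
    · have hd := congrArg derivative hr
      simp only [derivative_mul, derivative_add, derivative_sub, derivative_natCast, derivative_one,
        derivative_X, derivative_ofNat] at hd
      have hn : (n : ℝ[X]) + 1 + (e : ℝ[X]) ≠ 0 := by exact_mod_cast (by omega : n + 1 + e ≠ 0)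
      refine mul_left_cancel₀ hn ?_
      push_cast
      linear_combination (1 - X ^ 2) * hd
        + (2 * (n : ℝ[X]) + 2 + (e : ℝ[X])) * X * h1 - ((n : ℝ[X]) + 1) * h2
        + ((n : ℝ[X]) + 2) * X * hr
    · push_cast
      linear_combination h1 + hr

lemma ultrasphericalPoly_ode (n : ℕ) :
    (1 - X ^ 2) * derivative (derivative (P n))
      = ((e : ℝ[X]) + 1) * X * derivative (P n) - (n : ℝ[X]) * ((n : ℝ[X]) + (e : ℝ[X])) * P n := by
  rcases n with _ | n
  · simp [ultrasphericalPoly]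
  obtain ⟨h1, h2⟩ := ultrasphericalPoly_structure e n
  have hX : (1 - X ^ 2 : ℝ[X]) ≠ 0 := by
    intro h
    simpa using congrArg (eval 0) h
  -- Eliminates the derivative of `P n` that appears when the first structure relation is
  -- differentiated.
  have hD : ((n : ℝ[X]) + 1) * derivative (P n)
      = ((n : ℝ[X]) + (e : ℝ[X])) * (X * derivative (P (n + 1)) - ((n : ℝ[X]) + 1) * P (n + 1)) := by
    refine mul_left_cancel₀ hX ?_
    linear_combination ((n : ℝ[X]) + 1) * h2 - ((n : ℝ[X]) + (e : ℝ[X])) * X * h1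
  have hd := congrArg derivative h1
  simp only [derivative_mul, derivative_add, derivative_sub, derivative_natCast, derivative_one,
    derivative_X_pow, derivative_X] at hd
  simp [C_ofNat] at hd
  push_cast
  linear_combination hd + hD

lemma abs_ultrasphericalPoly_eval_le_one (n : ℕ) {x : ℝ} (hx : x ∈ Icc (-1 : ℝ) 1) :
    |(P n).eval x| ≤ 1 := by
  rcases Nat.eq_zero_or_pos n with rfl | hn
  · simp [ultrasphericalPoly]
  -- Sonin's function. By the differential equation `V' = 2 e x (P n)'^2`, so `V` is largest at
  -- `±1`, where it equals `n (n + e)`.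
  set V : ℝ[X] := (n : ℝ[X]) * ((n : ℝ[X]) + (e : ℝ[X])) * P n ^ 2 + (1 - X ^ 2) * derivative (P n) ^ 2 with hV
  have hV' : derivative V = 2 * (e : ℝ[X]) * X * derivative (P n) ^ 2 := by
    simp only [hV, derivative_mul, derivative_add, derivative_sub, derivative_natCast,
      derivative_one, derivative_pow]
    simp [C_ofNat]
    linear_combination 2 * derivative (P n) * ultrasphericalPoly_ode e n
  have hVx : (n * (n + e) : ℝ) * (P n).eval x ^ 2 ≤ V.eval x := by
    have h : 0 ≤ (1 - x ^ 2) * (derivative (P n)).eval x ^ 2 :=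
      mul_nonneg (by nlinarith [hx.1, hx.2]) (sq_nonneg _)
    simpa [hV] using h
  have hV1 : V.eval 1 = n * (n + e) := by simp [hV, ultrasphericalPoly_eval_one]
  have hV2 : V.eval (-1) = n * (n + e) := by
    simp [hV, ultrasphericalPoly_eval_neg_one, ← pow_mul, mul_comm n 2]
  have hle : V.eval x ≤ n * (n + e) := by
    rcases le_total 0 x with h0 | h0
    · rw [← hV1]
      refine monotoneOn_of_deriv_nonneg (convex_Icc (0 : ℝ) 1) V.continuous.continuousOn
        V.differentiable.differentiableOn (fun y hy => ?_) ⟨h0, hx.2⟩ (by norm_num) hx.2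
      rw [interior_Icc] at hy
      rw [Polynomial.deriv, hV']
      have := hy.1
      simp
      positivity
    · rw [← hV2]
      refine antitoneOn_of_deriv_nonpos (convex_Icc (-1 : ℝ) 0) V.continuous.continuousOn
        V.differentiable.differentiableOn (fun y hy => ?_) (by norm_num) ⟨hx.1, h0⟩ hx.1
      rw [interior_Icc] at hy
      rw [Polynomial.deriv, hV']
      have h1 : 0 ≤ -y := by linarith [hy.2]
      have h2 : 0 ≤ 2 * (e : ℝ) * (-y) * (derivative (P n)).eval y ^ 2 := by positivity
      simp
      linarith
  have hpos : (0 : ℝ) < n * (n + e) := by positivity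
  have hsq : (P n).eval x ^ 2 ≤ 1 := by
    by_contra! h
    nlinarith
  exact (sq_le_one_iff_abs_le_one _).1 hsq

open Real in
-- Sturm–Liouville argument: `sin^{e+1} θ` times the Wronskian at `cos θ` vanishes at `0` and `π`,
-- and its derivative is a nonzero multiple of the integrand. The variable `θ` avoids the singular
-- weight `(1 - x²)^{-1/2}` at `e = 0`.
lemma integral_sin_pow_mul_ultrasphericalPoly {n m : ℕ} (hnm : n ≠ m) :
    ∫ θ in (0 : ℝ)..π, sin θ ^ e * ((P n).eval (cos θ) * (P m).eval (cos θ)) = 0 := by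
  set W : ℝ[X] := P n * derivative (P m) - derivative (P n) * P m with hW
  have hW' : (1 - X ^ 2) * derivative W
      = ((e : ℝ[X]) + 1) * X * W + ((n : ℝ[X]) * ((n : ℝ[X]) + (e : ℝ[X]))
        - (m : ℝ[X]) * ((m : ℝ[X]) + (e : ℝ[X]))) * (P n * P m) := by
    simp only [hW, derivative_mul, derivative_sub]
    linear_combination P n * ultrasphericalPoly_ode e m - P m * ultrasphericalPoly_ode e n
  set c : ℝ := m * (m + e) - n * (n + e) with hc
  have hc0 : c ≠ 0 := by
    have h : c = (m - n) * (m + n + e) := by rw [hc]; ring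
    rw [h]
    have h1 : (m : ℝ) - n ≠ 0 := sub_ne_zero.2 (by exact_mod_cast hnm.symm)
    have h2 : (m + n + e : ℝ) ≠ 0 := by exact_mod_cast (by omega : m + n + e ≠ 0)
    exact mul_ne_zero h1 h2
  have hderiv (θ : ℝ) : HasDerivAt (fun θ => sin θ ^ (e + 1) * W.eval (cos θ))
      (c * (sin θ ^ e * ((P n).eval (cos θ) * (P m).eval (cos θ)))) θ := by
    have h := ((hasDerivAt_sin θ).fun_pow (e + 1)).mul
      ((W.hasDerivAt (cos θ)).comp θ (hasDerivAt_cos θ))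
    convert! h using 1
    have h2 := congrArg (eval (cos θ)) hW'
    simp at h2
    have h3 : sin θ ^ 2 = 1 - cos θ ^ 2 := by rw [sin_sq]
    simp only [hc, Nat.add_sub_cancel, pow_succ, Function.comp_apply]
    push_cast
    linear_combination sin θ ^ e * h2 + sin θ ^ e * (derivative W).eval (cos θ) * h3
  have hint := intervalIntegral.integral_eq_sub_of_hasDerivAt (a := 0) (b := π)
    (fun θ _ => hderiv θ) (Continuous.intervalIntegrable (by fun_prop) _ _)
  rw [intervalIntegral.integral_const_mul] at hint
  simpa [hc0] using hint

open Real in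
lemma integral_sin_pow_mul_ultrasphericalPoly_sq_pos (n : ℕ) :
    0 < ∫ θ in (0 : ℝ)..π, sin θ ^ e * ((P n).eval (cos θ) * (P n).eval (cos θ)) := by
  refine intervalIntegral.integral_pos pi_pos (by fun_prop) (fun θ hθ => ?_) ?_
  · exact mul_nonneg (pow_nonneg (sin_nonneg_of_mem_Icc (Ioc_subset_Icc_self hθ)) _)
      (mul_self_nonneg _)
  · have hc : ContinuousAt (fun θ => (P n).eval (cos θ)) 0 := by fun_prop
    have hne : ∀ᶠ θ in 𝓝 (0 : ℝ), (P n).eval (cos θ) ≠ 0 :=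
      hc.eventually_ne (by simp [ultrasphericalPoly_eval_one])
    obtain ⟨θ, h1, h2⟩ := ((eventually_nhdsWithin_of_eventually_nhds hne).and
      (Ioo_mem_nhdsGT pi_pos)).exists
    exact ⟨θ, Ioo_subset_Icc_self h2,
      mul_pos (pow_pos (sin_pos_of_mem_Ioo h2) _) (mul_self_pos.2 h1)⟩

open Real in
-- Integrate the series termwise against `sin^e θ · P m (cos θ)`, with majorant `‖a n‖`;
-- orthogonality isolates `a m`.
lemma eq_zero_of_hasSum_ultrasphericalPoly {a : ℕ → ℂ} (ha : Summable fun n => ‖a n‖)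
    (h : ∀ x ∈ Icc (-1 : ℝ) 1, HasSum (fun n => a n * (((P n).eval x : ℝ) : ℂ)) 0) : a = 0 := by
  ext m
  have hb (n : ℕ) (θ : ℝ) : |(P n).eval (cos θ)| ≤ 1 :=
    abs_ultrasphericalPoly_eval_le_one e n (cos_mem_Icc θ)
  set F : ℕ → ℝ → ℂ := fun n θ =>
    a n * ((sin θ ^ e * ((P n).eval (cos θ) * (P m).eval (cos θ)) : ℝ) : ℂ) with hF
  have hsum : HasSum (fun n => ∫ θ in (0 : ℝ)..π, F n θ) (∫ θ in (0 : ℝ)..π, (0 : ℂ)) := by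
    refine intervalIntegral.hasSum_integral_of_dominated_convergence (fun n _ => ‖a n‖)
      (fun n => ?_) (fun n => .of_forall fun θ _ => ?_) (.of_forall fun θ _ => ha)
      (by simp) (.of_forall fun θ _ => ?_)
    · exact Continuous.aestronglyMeasurable (by fun_prop)
    · rw [hF, norm_mul, Complex.norm_real, norm_mul, norm_mul, norm_pow]
      refine mul_le_of_le_one_right (norm_nonneg _) ?_
      exact mul_le_one₀ (pow_le_one₀ (norm_nonneg _) (abs_sin_le_one θ)) (by positivity)
        (mul_le_one₀ (hb n θ) (norm_nonneg _) (hb m θ))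
    · have h1 := (h (cos θ) (cos_mem_Icc θ)).mul_right
        ((sin θ ^ e * (P m).eval (cos θ) : ℝ) : ℂ)
      rw [zero_mul] at h1
      convert! h1 using 2 with n
      simp only [hF]
      push_cast
      ring
  have hI (n : ℕ) : ∫ θ in (0 : ℝ)..π, F n θ = a n *
      ((∫ θ in (0 : ℝ)..π, sin θ ^ e * ((P n).eval (cos θ) * (P m).eval (cos θ)) : ℝ) : ℂ) := by
    rw [hF, intervalIntegral.integral_const_mul, intervalIntegral.integral_ofReal]
  simp_rw [hI, intervalIntegral.integral_zero] at hsum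
  have h1 := hsum.unique (hasSum_single m fun n hn => by
    rw [integral_sin_pow_mul_ultrasphericalPoly e hn, Complex.ofReal_zero, mul_zero])
  have h2 := (integral_sin_pow_mul_ultrasphericalPoly_sq_pos e m).ne'
  simpa [h2] using h1.symm

lemma gegenbauerC_add_two (a : ℝ) (n : ℕ) (x : ℝ) :
    (n + 2) * gegenbauerC a (n + 2) x = 2 * ((n : ℝ) + 1 + a) * x * gegenbauerC a (n + 1) x
      - ((n : ℝ) + 2 * a) * gegenbauerC a n x := by
  rw [gegenbauerC, mul_div_cancel₀]
  positivity

lemma gegenbauerC_one_rec (n : ℕ) :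
    (n + 1) * gegenbauerC (e / 2) (n + 1) 1 = (n + e) * gegenbauerC (e / 2) n 1 := by
  induction n with
  | zero => simp [gegenbauerC]; ring
  | succ n ih =>
    push_cast
    linear_combination gegenbauerC_add_two (e / 2) n 1 + ih

lemma gegenbauerC_one_pos (he : 0 < e) (n : ℕ) : 0 < gegenbauerC (e / 2) n 1 := by
  induction n with
  | zero => simp [gegenbauerC]
  | succ n ih =>
    have h := gegenbauerC_one_rec e n
    have h1 : 0 < (n + 1 : ℝ) * gegenbauerC (e / 2) (n + 1) 1 := by rw [h]; positivity
    exact pos_of_mul_pos_right h1 (by positivity)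

lemma gegenbauerC_eq (n : ℕ) (x : ℝ) :
    gegenbauerC (e / 2) n x = gegenbauerC (e / 2) n 1 * (P n).eval x := by
  induction n using Nat.twoStepInduction with
  | zero => simp [gegenbauerC, ultrasphericalPoly]
  | one => simp [gegenbauerC, ultrasphericalPoly]
  | more n h0 h1 =>
    have hr := ultrasphericalPoly_eval_rec e n x
    have g1 := gegenbauerC_one_rec e n
    have g2 := gegenbauerC_one_rec e (n + 1)
    have hn : (n + 2 : ℝ) ≠ 0 := by positivity
    refine mul_left_cancel₀ hn ?_
    push_cast at g2
    rw [gegenbauerC_add_two, h0, h1]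
    linear_combination gegenbauerC (e / 2) (n + 1) 1 * (-hr) + (P n).eval x * g1
      - (P (n + 2)).eval x * g2

/-- The Chebyshev case `e = 0` is separate because Gegenbauer polynomials with parameter `0` vanish
for `n ≥ 1` and cannot be normalized. -/
lemma ultraspherical_eq (n : ℕ) (x : ℝ) : ultraspherical n (e + 1) x = (P n).eval x := by
  rcases Nat.eq_zero_or_pos e with rfl | he
  · simp only [ultraspherical, zero_add, if_true]
    induction n using Nat.twoStepInduction with
    | zero => simp [ultrasphericalPoly]
    | one => simp [ultrasphericalPoly]
    | more n h0 h1 =>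
      have hr := ultrasphericalPoly_eval_rec 0 n x
      have hT : (Chebyshev.T ℝ ((n + 2 : ℕ) : ℤ)).eval x
          = 2 * x * (Chebyshev.T ℝ ((n + 1 : ℕ) : ℤ)).eval x - (Chebyshev.T ℝ n).eval x := by
        push_cast
        rw [Chebyshev.T_add_two]
        simp
      simp only [Nat.cast_zero, add_zero] at hr
      rw [hT, h0, h1]
      have hn : (n + 1 : ℝ) ≠ 0 := by positivity
      refine mul_left_cancel₀ hn ?_
      linear_combination -hr
  · rw [ultraspherical, if_neg (by omega)]
    have h : (((e + 1 : ℕ) : ℝ) - 1) / 2 = e / 2 := by push_cast; ring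
    rw [h, gegenbauerC_eq, mul_div_cancel_left₀ _ (gegenbauerC_one_pos e he n).ne']

end UltrasphericalPoly

/-! ### Expansion of monomials in ultraspherical polynomials. -/

section ConnectionCoeff

/-- The coefficient of the polynomial of index `n + 1` in the product of `x` and the normalized
ultraspherical polynomial of index `n`. -/
noncomputable def raisingCoeff (e : ℕ) : ℕ → ℝ
  | 0 => 1
  | n + 1 => (n + 1 + e) / (2 * n + 2 + e)

/-- The coefficient of the polynomial of index `n` in the product of `x` and the normalized
ultraspherical polynomial of index `n + 1`. -/
noncomputable def loweringCoeff (e n : ℕ) : ℝ := (n + 1) / (2 * n + 2 + e)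

/-- The coefficient of the normalized ultraspherical polynomial of index `n` in `x ^ k`. -/
noncomputable def connectionCoeff (e : ℕ) : ℕ → ℕ → ℝ
  | 0, 0 => 1
  | 0, _ + 1 => 0
  | k + 1, 0 => connectionCoeff e k 1 * loweringCoeff e 0
  | k + 1, n + 1 => connectionCoeff e k n * raisingCoeff e n
      + connectionCoeff e k (n + 2) * loweringCoeff e (n + 1)

lemma raisingCoeff_nonneg (e n : ℕ) : 0 ≤ raisingCoeff e n := by
  cases n <;> simp only [raisingCoeff] <;> positivity

lemma loweringCoeff_nonneg (e n : ℕ) : 0 ≤ loweringCoeff e n := by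
  simp only [loweringCoeff]; positivity

lemma connectionCoeff_nonneg (e k n : ℕ) : 0 ≤ connectionCoeff e k n := by
  induction k generalizing n with
  | zero => cases n <;> simp [connectionCoeff]
  | succ k ih =>
    cases n with
    | zero => exact mul_nonneg (ih _) (loweringCoeff_nonneg _ _)
    | succ n =>
      exact add_nonneg (mul_nonneg (ih _) (raisingCoeff_nonneg _ _))
        (mul_nonneg (ih _) (loweringCoeff_nonneg _ _))

lemma connectionCoeff_eq_zero (e : ℕ) {k n : ℕ} (h : k < n) : connectionCoeff e k n = 0 := by
  induction k generalizing n with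
  | zero =>
    obtain ⟨n, rfl⟩ := Nat.exists_eq_add_of_lt h
    simp [connectionCoeff]
  | succ k ih =>
    obtain ⟨n, rfl⟩ := Nat.exists_eq_succ_of_ne_zero (by omega : n ≠ 0)
    simp [connectionCoeff, ih (show k < n by omega), ih (show k < n + 2 by omega)]

lemma mul_ultrasphericalPoly_eval_succ (e n : ℕ) (x : ℝ) :
    x * (ultrasphericalPoly e (n + 1)).eval x
      = raisingCoeff e (n + 1) * (ultrasphericalPoly e (n + 2)).eval x
        + loweringCoeff e n * (ultrasphericalPoly e n).eval x := by
  have h := ultrasphericalPoly_eval_rec e n x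
  have h0 : (2 * n + 2 + e : ℝ) ≠ 0 := by positivity
  simp only [raisingCoeff, loweringCoeff]
  field_simp
  linear_combination -h

lemma sum_connectionCoeff (e : ℕ) (x : ℝ) {k N : ℕ} (h : k < N) :
    ∑ n ∈ Finset.range N, connectionCoeff e k n * (ultrasphericalPoly e n).eval x = x ^ k := by
  induction k generalizing N with
  | zero =>
    obtain ⟨N, rfl⟩ := Nat.exists_eq_succ_of_ne_zero h.ne'
    simp [Finset.sum_range_succ', connectionCoeff, ultrasphericalPoly]
  | succ k ih =>
    obtain ⟨M, rfl⟩ := Nat.exists_eq_succ_of_ne_zero (by omega : N ≠ 0)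
    have hM : k < M := by omega
    set c : ℕ → ℝ := fun n => (ultrasphericalPoly e n).eval x with hc
    set a := connectionCoeff e k with ha
    have hx0 : x * c 0 = raisingCoeff e 0 * c 1 := by
      simp [hc, ultrasphericalPoly, raisingCoeff]
    -- The boundary term drops because `x ^ k` has no component of index above `k`.
    have h1 : ∑ n ∈ Finset.range (M + 1), a n * raisingCoeff e n * c (n + 1)
        = ∑ n ∈ Finset.range M, a n * raisingCoeff e n * c (n + 1) := by
      rw [Finset.sum_range_succ, ha, connectionCoeff_eq_zero e hM]
      ring
    have h2 : ∑ n ∈ Finset.range (M + 1), a (n + 1) * loweringCoeff e n * c n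
        = ∑ n ∈ Finset.range M, a (n + 1) * loweringCoeff e n * c n := by
      rw [Finset.sum_range_succ, ha, connectionCoeff_eq_zero e (by omega : k < M + 1)]
      ring
    calc ∑ n ∈ Finset.range (M + 1), connectionCoeff e (k + 1) n * c n
        = ∑ n ∈ Finset.range (M + 1), a n * raisingCoeff e n * c (n + 1)
          + ∑ n ∈ Finset.range (M + 1), a (n + 1) * loweringCoeff e n * c n := by
          rw [h1, Finset.sum_range_succ', Finset.sum_range_succ' _ M, ← add_assoc,
            ← Finset.sum_add_distrib]
          simp only [connectionCoeff, ← ha, add_mul, zero_add]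
      _ = ∑ n ∈ Finset.range (M + 1), a n * c n * x := by
          rw [h2, Finset.sum_range_succ', Finset.sum_range_succ' _ M, add_right_comm,
            ← Finset.sum_add_distrib]
          congr 1
          · refine Finset.sum_congr rfl fun n _ => ?_
            linear_combination -a (n + 1) * mul_ultrasphericalPoly_eval_succ e n x
          · linear_combination -a 0 * hx0
      _ = x ^ (k + 1) := by
          rw [← Finset.sum_mul, ih (by omega : k < M + 1), pow_succ]

lemma hasSum_connectionCoeff_mul (e k : ℕ) (x : ℝ) :
    HasSum (fun n => connectionCoeff e k n * (ultrasphericalPoly e n).eval x) (x ^ k) := by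
  rw [← sum_connectionCoeff e x k.lt_succ_self]
  refine hasSum_sum_of_ne_finset_zero fun n hn => ?_
  have := mt Finset.mem_range.2 hn
  rw [connectionCoeff_eq_zero e (by omega), zero_mul]

/-- Evaluation at `x = 1`: for fixed `k` the coefficients form a probability distribution in `n`. -/
lemma hasSum_connectionCoeff (e k : ℕ) : HasSum (connectionCoeff e k) 1 := by
  simpa [ultrasphericalPoly_eval_one] using hasSum_connectionCoeff_mul e k 1

lemma connectionCoeff_le_one (e k n : ℕ) : connectionCoeff e k n ≤ 1 :=
  le_hasSum (hasSum_connectionCoeff e k) n fun m _ => connectionCoeff_nonneg e k m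

lemma tendsto_loweringCoeff (n : ℕ) : Tendsto (fun e => loweringCoeff e n) atTop (𝓝 0) :=
  tendsto_const_nhds.div_atTop (tendsto_atTop_add_const_left _ _ tendsto_natCast_atTop_atTop)

lemma tendsto_raisingCoeff (n : ℕ) : Tendsto (fun e => raisingCoeff e n) atTop (𝓝 1) := by
  cases n with
  | zero => exact tendsto_const_nhds
  | succ n =>
    have h := (tendsto_loweringCoeff n).const_sub 1
    rw [sub_zero] at h
    refine h.congr fun e => ?_
    have h0 : (2 * n + 2 + e : ℝ) ≠ 0 := by positivity
    simp only [raisingCoeff, loweringCoeff]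
    field_simp
    ring

/-- Multiplication by `x` is a random walk on the indices whose downward probabilities tend to `0`;
in the limit all `k` steps go up. -/
lemma tendsto_connectionCoeff (k n : ℕ) :
    Tendsto (fun e => connectionCoeff e k n) atTop (𝓝 (if k = n then 1 else 0)) := by
  induction k generalizing n with
  | zero => cases n <;> simp [connectionCoeff]
  | succ k ih =>
    cases n with
    | zero => simpa [connectionCoeff] using (ih 1).mul (tendsto_loweringCoeff 0)
    | succ n =>
      simpa [connectionCoeff] using ((ih n).mul (tendsto_raisingCoeff n)).add
        ((ih (n + 2)).mul (tendsto_loweringCoeff (n + 1)))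

end ConnectionCoeff

/-! ### Schoenberg functions and their limit as the dimension grows. -/

section SchoenbergSequence

variable {L : Type*} [Group L] [TopologicalSpace L] {f : ℝ × L → ℂ} {φ : ℕ → L → ℂ}

/-- The Schoenberg functions on the sphere of dimension `e + 1` obtained from the coefficients of
a power series by expanding the monomials in ultraspherical polynomials. -/
noncomputable def schoenbergOfPower (φ : ℕ → L → ℂ) (e n : ℕ) (u : L) : ℂ :=
  ∑' k, φ k u * connectionCoeff e k n

omit [TopologicalSpace L] in
lemma norm_mul_connectionCoeff_le (hφ : ∀ n, IsPosDefKernel fun u v : L => φ n (u⁻¹ * v))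
    (e k n : ℕ) (u : L) : ‖φ k u * connectionCoeff e k n‖ ≤ (φ k 1).re := by
  rw [norm_mul, Complex.norm_real, Real.norm_of_nonneg (connectionCoeff_nonneg _ _ _)]
  exact (mul_le_of_le_one_right (norm_nonneg _) (connectionCoeff_le_one _ _ _)).trans
    ((hφ k).norm_le u)

lemma IsPowerSequence.summable_mul_connectionCoeff (h : IsPowerSequence f φ) (e n : ℕ) (u : L) :
    Summable fun k => φ k u * (connectionCoeff e k n : ℂ) :=
  .of_norm_bounded (summable_re_apply_one h.2.1)
    fun k => norm_mul_connectionCoeff_le (fun n => (h.1 n).2) e k n u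

lemma IsPowerSequence.schoenbergOfPower_mem (h : IsPowerSequence f φ) (e n : ℕ) :
    schoenbergOfPower φ e n ∈ PosDefGroup L := by
  constructor
  · exact continuous_tsum (fun k => (h.1 k).1.mul continuous_const) (summable_re_apply_one h.2.1)
      fun k u => norm_mul_connectionCoeff_le (fun n => (h.1 n).2) e k n u
  · exact .tsum (fun k => (h.1 k).2.mul_const
      (Complex.zero_le_real.2 (connectionCoeff_nonneg e k n)))
      fun u v => h.summable_mul_connectionCoeff e n (u⁻¹ * v)

/-- Interchange of a double series, absolutely summable with majorant `φ_k(e)` times the connection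
coefficients, whose rows sum to `φ_k(e)`. -/
lemma IsPowerSequence.hasSum_schoenbergOfPower (h : IsPowerSequence f φ) (e : ℕ) {x : ℝ}
    (hx : x ∈ Icc (-1 : ℝ) 1) (u : L) :
    HasSum (fun n => schoenbergOfPower φ e n u * (((ultrasphericalPoly e n).eval x : ℝ) : ℂ))
      (f (x, u)) := by
  set F : ℕ × ℕ → ℂ := fun p => φ p.1 u * connectionCoeff e p.1 p.2
    * (((ultrasphericalPoly e p.2).eval x : ℝ) : ℂ) with hF
  have hb (k : ℕ) : 0 ≤ (φ k 1).re := (norm_nonneg _).trans ((h.1 k).2.norm_le u)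
  have hG : Summable fun p : ℕ × ℕ => (φ p.1 1).re * connectionCoeff e p.1 p.2 := by
    rw [summable_prod_of_nonneg fun p => mul_nonneg (hb _) (connectionCoeff_nonneg _ _ _)]
    have h1 (k : ℕ) := (hasSum_connectionCoeff e k).mul_left (φ k 1).re
    refine ⟨fun k => (h1 k).summable, ?_⟩
    simp only [fun k => (h1 k).tsum_eq, mul_one]
    exact summable_re_apply_one h.2.1
  have hFs : Summable F := by
    refine .of_norm_bounded hG fun p => ?_
    rw [hF, norm_mul, norm_mul, Complex.norm_real, Complex.norm_real,
      Real.norm_of_nonneg (connectionCoeff_nonneg _ _ _)]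
    calc ‖φ p.1 u‖ * connectionCoeff e p.1 p.2 * ‖(ultrasphericalPoly e p.2).eval x‖
        ≤ (φ p.1 1).re * connectionCoeff e p.1 p.2 * 1 := by
          have := connectionCoeff_nonneg e p.1 p.2
          have := hb p.1
          gcongr
          · exact (h.1 p.1).2.norm_le u
          · exact abs_ultrasphericalPoly_eval_le_one e p.2 hx
      _ = _ := mul_one _
  have hrow (k : ℕ) : HasSum (fun n => F (k, n)) (φ k u * (x : ℂ) ^ k) := by
    have h1 := (Complex.ofRealCLM.hasSum (hasSum_connectionCoeff_mul e k x)).mul_left (φ k u)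
    simpa [hF, mul_assoc] using h1
  have htot : ∑' p, F p = f (x, u) :=
    (hFs.hasSum.prod_fiberwise hrow).unique (h.2.2 x hx u)
  have hswap := (Equiv.prodComm ℕ ℕ).hasSum_iff.2 hFs.hasSum
  rw [htot] at hswap
  refine hswap.prod_fiberwise fun n => ?_
  exact (h.summable_mul_connectionCoeff e n u).hasSum.mul_right _

lemma IsPowerSequence.isSchoenbergSequence (h : IsPowerSequence f φ) (e : ℕ) :
    IsSchoenbergSequence (e + 1) f (schoenbergOfPower φ e) := by
  refine ⟨h.schoenbergOfPower_mem e, ?_, fun x hx u => ?_⟩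
  · simpa [ultrasphericalPoly_eval_one] using
      (h.hasSum_schoenbergOfPower e (x := 1) (by norm_num) 1).summable
  · simpa only [ultraspherical_eq] using h.hasSum_schoenbergOfPower e hx u

lemma IsSchoenbergSequence.unique {e : ℕ} {ψ χ : ℕ → L → ℂ}
    (hψ : IsSchoenbergSequence (e + 1) f ψ) (hχ : IsSchoenbergSequence (e + 1) f χ) : ψ = χ := by
  ext n u
  have h := eq_zero_of_hasSum_ultrasphericalPoly e (a := fun n => ψ n u - χ n u) ?_ fun x hx => ?_
  · exact sub_eq_zero.1 (congrFun h n)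
  · refine .of_nonneg_of_le (fun n => norm_nonneg _) (fun n => (norm_sub_le _ _).trans
      (add_le_add ((hψ.1 n).2.norm_le u) ((hχ.1 n).2.norm_le u)))
      ((summable_re_apply_one hψ.2.1).add (summable_re_apply_one hχ.2.1))
  · simpa only [ultraspherical_eq, sub_mul, sub_self] using (hψ.2.2 x hx u).sub (hχ.2.2 x hx u)

/-- The difference is bounded by `∑ φ_k(e) |δ_{kn} - connectionCoeff e k n|`, which does not involve
`u` and tends to `0` by dominated convergence. -/
lemma IsPowerSequence.tendstoUniformly_schoenbergOfPower (h : IsPowerSequence f φ) (n : ℕ) :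
    TendstoUniformly (fun e => schoenbergOfPower φ e n) (φ n) atTop := by
  have hb := summable_re_apply_one h.2.1
  set δ : ℕ → ℝ := fun k => if k = n then 1 else 0 with hδ
  have hle (e k : ℕ) : |δ k - connectionCoeff e k n| ≤ 1 := by
    have h0 := connectionCoeff_nonneg e k n
    have h1 := connectionCoeff_le_one e k n
    rw [abs_le]
    by_cases hk : k = n <;> simp only [hδ, hk, if_true, if_false] at * <;>
      constructor <;> linarith
  have hterm (e k : ℕ) (u : L) : ‖φ k u * ((δ k - connectionCoeff e k n : ℝ) : ℂ)‖
      ≤ (φ k 1).re * |δ k - connectionCoeff e k n| := by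
    rw [norm_mul, Complex.norm_real, Real.norm_eq_abs]
    exact mul_le_mul_of_nonneg_right ((h.1 k).2.norm_le u) (abs_nonneg _)
  have hpos (k : ℕ) : 0 ≤ (φ k 1).re := (norm_nonneg _).trans ((h.1 k).2.norm_le 1)
  have hbound (e k : ℕ) : (φ k 1).re * |δ k - connectionCoeff e k n| ≤ (φ k 1).re :=
    mul_le_of_le_one_right (hpos k) (hle e k)
  have hlim : Tendsto (fun e => ∑' k, (φ k 1).re * |δ k - connectionCoeff e k n|) atTop
      (𝓝 0) := by
    have h1 := tendsto_tsum_of_dominated_convergence (𝓕 := atTop)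
      (f := fun e k => (φ k 1).re * |δ k - connectionCoeff e k n|) (g := fun _ => (0 : ℝ)) hb
      (fun k => ?_) (.of_forall fun e k => ?_)
    · simpa using h1
    · simpa [hδ] using (((tendsto_connectionCoeff k n).const_sub (δ k)).abs.const_mul (φ k 1).re)
    · rw [Real.norm_of_nonneg (mul_nonneg (hpos k) (abs_nonneg _))]
      exact hbound e k
  rw [Metric.tendstoUniformly_iff]
  intro ε hε
  filter_upwards [hlim.eventually (gt_mem_nhds hε)] with e he u
  have h1 : HasSum (fun k => φ k u * ((δ k - connectionCoeff e k n : ℝ) : ℂ))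
      (φ n u - schoenbergOfPower φ e n u) := by
    have h2 : HasSum (fun k => φ k u * (δ k : ℂ)) (φ n u) := by
      simpa [hδ] using hasSum_single (f := fun k => φ k u * (δ k : ℂ)) n
        fun k hk => by simp [hδ, hk]
    simpa [mul_sub, schoenbergOfPower] using h2.sub (h.summable_mul_connectionCoeff e n u).hasSum
  rw [dist_eq_norm, ← h1.tsum_eq]
  exact (tsum_of_norm_bounded (Summable.of_nonneg_of_le
    (fun k => mul_nonneg (hpos k) (abs_nonneg _)) (hbound e) hb).hasSum
    fun k => hterm e k u).trans_lt he

end SchoenbergSequence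

theorem theorem1p3 {L : Type*} [Group L] [TopologicalSpace L] [IsTopologicalGroup L]
    [LocallyCompactSpace L] (f : ℝ × L → ℂ) (hf : f ∈ PosDefSphereInfty L) :
    -- the functions `φ_{n,d}` exist and are unique, and the derivatives exist
    (∀ d : ℕ, 1 ≤ d → ∃! ψ : ℕ → L → ℂ, IsSchoenbergSequence d f ψ) ∧
    (∀ u : L, ContDiffOn ℝ ∞ (fun x : ℝ => f (x, u)) (Ioo (-1) 1)) ∧
    -- convergence as `d → ∞`, uniformly on compact sets
    (∀ φ : ℕ → ℕ → L → ℂ,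
      (∀ d : ℕ, 1 ≤ d → IsSchoenbergSequence d f (fun n => φ n d)) →
      ∀ (n : ℕ) (K : Set L), IsCompact K →
        TendstoUniformlyOn (fun d : ℕ => φ n d) (taylorCoeff f n) atTop K) ∧
    -- the limits are in `𝒫(L)` and are the coefficients of the power series of `f`
    (∀ n : ℕ, taylorCoeff f n ∈ PosDefGroup L) ∧
    (∀ ψ : ℕ → L → ℂ, IsPowerSequence f ψ ↔ ψ = taylorCoeff f) ∧
    TendstoUniformlyOn
      (fun (N : ℕ) (p : ℝ × L) => ∑ n ∈ Finset.range N, taylorCoeff f n p.2 * (p.1 : ℂ) ^ n)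
      f atTop (Icc (-1) 1 ×ˢ univ) := by
  obtain ⟨φ, hφ⟩ := exists_isPowerSequence hf
  obtain rfl := hφ.eq_taylorCoeff
  refine ⟨fun d hd => ?_, hφ.contDiffOn, fun φ hφd n K _ => ?_, fun n => hφ.1 n,
    fun ψ => ⟨fun h => h.eq_taylorCoeff, fun h => h ▸ hφ⟩, hφ.tendstoUniformlyOn⟩
  · obtain ⟨e, rfl⟩ := Nat.exists_eq_add_of_le' hd
    exact ⟨_, hφ.isSchoenbergSequence e, fun ψ hψ => hψ.unique (hφ.isSchoenbergSequence e)⟩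
  · have h := hφ.tendstoUniformly_schoenbergOfPower n
    rw [Metric.tendstoUniformly_iff] at h
    rw [Metric.tendstoUniformlyOn_iff]
    intro ε hε
    -- Passage from `e = d - 1` back to `d`; nothing is assumed about `φ n 0`, so `d ≥ 1` is
    -- imposed.
    filter_upwards [(tendsto_sub_atTop_nat 1).eventually (h ε hε), eventually_ge_atTop 1]
      with d hd h1 u _
    obtain ⟨e, rfl⟩ := Nat.exists_eq_add_of_le' h1
    have he := congrFun ((hφd (e + 1) h1).unique (hφ.isSchoenbergSequence e)) n
    change φ n (e + 1) = _ at he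
    rw [he]
    exact hd u
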